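/- Let $\mathcal{E}$ be a finite-dimensional complex Hilbert space, $\mathcal{A}$ the algebra of all linear operators on $\mathcal{E}$, and $\omega$ a faithful state on $\mathcal{A}$ (a linear map $\omega:\mathcal{A}\to\mathbb{C}$ with $\omega(1)=1$, $\omega(a^*a)\ge 0$ for all $a$, and $\omega(a^*a)=0$ only for $a=0$). Let $h\in\mathcal{A}$ be self-adjoint, $T>0$, and $b_1,\dots,b_r\in\mathcal{A}$ arbitrary. **Restricted thermodynamic stability.** For an anti-Hermitian $M\in\mathbb{C}^{r\times r}$ and a positive semidefinite $\Lambda\in\mathbb{C}^{r\times r}$ let $$L_{M,\Lambda}(a)=\sum_{i,j}\Big\{-\tfrac12 M_{ij}[b_i^*b_j,a]+\Lambda_{ij}\big(b_i^*ab_j-\tfrac12(b_i^*b_ja+ab_i^*b_j)\big)\Big\}.$$ Let $F(\varphi)=-T\,S(\varphi)+\varphi(h)$ be the free energy, where $S(\varphi)=-\operatorname{tr}(\rho\log\rho)$ and $\rho$ is the density operator of $\varphi$, i.e. $\varphi(a)=\operatorname{tr}(\rho a)$. The pair $(\omega,h)$ has RTS at temperature $T$ with respect to $b_1,\dots,b_r$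 if for all such $M,\Lambda$ the derivative at $t=0$ of $F(\omega\circ e^{tL_{M,\Lambda}})$ (which exists) is $\ge 0$. **GNS data.** Let $\mathcal{H}_\omega$ be the space $\mathcal{A}$, with vectors written $|a\rangle$, and inner product $\langle a|b\rangle=\omega(a^*b)$. Let $\pi_\ell(a)|b\rangle=|ab\rangle$, $\pi_r(a)|b\rangle=|ba^*\rangle$ and $H=\pi_\ell(h)-\pi_r(h)$. Let $\Delta$ be the modular operator, defined by $\langle a|\Delta|b\rangle=\omega(ba^*)$. The modular flow is $t\mapsto\Delta^{it}=e^{it\log\Delta}$, $t\in\mathbb{R}$. Let $K=\operatorname{span}(|b_1\rangle,\dots,|b_r\rangle)$ and let $P:\mathcal{H}_\omega\to K$ be the orthogonal projection, so that $P^\dagger$ is the inclusion of $K$. For an orthonormal basis $|a_1\rangle,\dots,|a_m\rangle$ of $K$ let $\boldsymbol\Delta$ and $\boldsymbol H$ be the $m\times m$ matrices of $P\Delta P^\dagger$ and $PHP^\dagger$ in this basis, that is $\boldsymbol\Delta_{ij}=\langle a_i|\Delta|a_j\rangle=\omega(a_ja_i^*)$ and $\boldsymbol H_{ij}=\langle a_i|H|a_j\rangle=\omega(a_i^*[h,a_j])$.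 **Proposition (matrix Araki–Sewell inequality).** For every such orthonormal basis: 1. If $(\omega,h)$ has RTS at temperature $T$ with respect to $b_1,\dots,b_r$, then $T\log(\boldsymbol\Delta)+\boldsymbol H$ is Hermitian and positive semidefinite. 2. Conversely, if $K$ is invariant under the modular flow of $\omega$ (that is, $\Delta^{it}K\subseteq K$ for all $t\in\mathbb{R}$) and $T\log(\boldsymbol\Delta)+\boldsymbol H$ is Hermitian and positive semidefinite, then $(\omega,h)$ has RTS at temperature $T$ with respect to $b_1,\dots,b_r$. -/

import Mathlib

open scoped ComplexOrder

noncomputable section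

variable {E : Type*} [NormedAddCommGroup E] [InnerProductSpace ℂ E] [CompleteSpace E]

/-- A faithful state on the algebra `E →L[ℂ] E` of all operators on a finite-dimensional Hilbert
space `E` (whose star is the adjoint). -/
structure FaithfulState (E : Type*) [NormedAddCommGroup E] [InnerProductSpace ℂ E]
    [CompleteSpace E] where
  toFunctional : (E →L[ℂ] E) →ₗ[ℂ] ℂ
  map_one' : toFunctional 1 = 1
  nonneg' : ∀ a : E →L[ℂ] E, 0 ≤ toFunctional (star a * a)
  faithful' : ∀ a : E →L[ℂ] E, toFunctional (star a * a) = 0 → a = 0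

/-- The Lindbladian
`L a = ∑ i j, (-(1/2) M i j [bᵢ* bⱼ, a] + Λ i j (bᵢ* a bⱼ - (1/2) (bᵢ* bⱼ a + a bᵢ* bⱼ)))`,
a (continuous) linear map on the operator algebra. -/
def lindbladian {r : ℕ} (b : Fin r → (E →L[ℂ] E)) (M Λ : Matrix (Fin r) (Fin r) ℂ) :
    (E →L[ℂ] E) →L[ℂ] (E →L[ℂ] E) :=
  ∑ i, ∑ j,
    ((-(1 / 2 : ℂ) * M i j) •
        (ContinuousLinearMap.mul ℂ (E →L[ℂ] E) (star (b i) * b j)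
          - (ContinuousLinearMap.mul ℂ (E →L[ℂ] E)).flip (star (b i) * b j))
      + Λ i j •
        (ContinuousLinearMap.mulLeftRight ℂ (E →L[ℂ] E) (star (b i)) (b j)
          - (1 / 2 : ℂ) •
            (ContinuousLinearMap.mul ℂ (E →L[ℂ] E) (star (b i) * b j)
              + (ContinuousLinearMap.mul ℂ (E →L[ℂ] E)).flip (star (b i) * b j))))

theorem lindbladian_apply {r : ℕ} (b : Fin r → (E →L[ℂ] E)) (M Λ : Matrix (Fin r) (Fin r) ℂ)
    (a : E →L[ℂ] E) :
    lindbladian b M Λ a = ∑ i, ∑ j,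
      ((-(1 / 2 : ℂ) * M i j) • (star (b i) * b j * a - a * (star (b i) * b j))
        + Λ i j • (star (b i) * a * b j
          - (1 / 2 : ℂ) • (star (b i) * b j * a + a * (star (b i) * b j)))) := by
  simp only [lindbladian, sum_apply]
  rfl

section FreeEnergy

variable [FiniteDimensional ℂ E]

/-- The trace of an operator. -/
def opTrace (a : E →L[ℂ] E) : ℂ := LinearMap.trace ℂ E (a : E →ₗ[ℂ] E)

/-- The density operator of a linear functional `φ` on the operators: the operator `ρ` with
`tr (ρ a) = φ a` for all `a` (see `opTrace_densityOperator_mul`). In an orthonormal basis `e` it is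
`∑ i j, φ (|e i⟩⟨e j|) |e j⟩⟨e i|`. -/
def densityOperator (φ : (E →L[ℂ] E) →ₗ[ℂ] ℂ) : E →L[ℂ] E :=
  ∑ i, ∑ j,
    φ (InnerProductSpace.rankOne ℂ (stdOrthonormalBasis ℂ E i) (stdOrthonormalBasis ℂ E j)) •
      InnerProductSpace.rankOne ℂ (stdOrthonormalBasis ℂ E j) (stdOrthonormalBasis ℂ E i)

theorem opTrace_densityOperator_mul (φ : (E →L[ℂ] E) →ₗ[ℂ] ℂ) (a : E →L[ℂ] E) :
    opTrace (densityOperator φ * a) = φ a := by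
  set e := stdOrthonormalBasis ℂ E with he
  have ha : a = ∑ i, ∑ j, inner ℂ (e i) (a (e j)) • InnerProductSpace.rankOne ℂ (e i) (e j) := by
    ext v
    simp only [sum_apply, smul_apply, InnerProductSpace.rankOne_apply]
    conv_lhs => rw [← e.sum_repr' v, map_sum]
    rw [Finset.sum_comm]
    refine Finset.sum_congr rfl fun j _ => ?_
    rw [map_smul]
    conv_lhs => rw [← e.sum_repr' (a (e j)), Finset.smul_sum]
    refine Finset.sum_congr rfl fun i _ => ?_
    rw [smul_comm]
  have hmul : ∀ i j, (InnerProductSpace.rankOne ℂ (e j) (e i) * a : E →L[ℂ] E)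
      = InnerProductSpace.rankOne ℂ (e j) (star a (e i)) := by
    intro i j
    ext v
    simp [InnerProductSpace.rankOne_apply, ContinuousLinearMap.star_eq_adjoint,
      ContinuousLinearMap.adjoint_inner_left]
  conv_rhs => rw [ha]
  simp only [densityOperator, ← he, Finset.sum_mul, smul_mul_assoc, hmul, opTrace,
    ContinuousLinearMap.toLinearMap_sum, ContinuousLinearMap.toLinearMap_smul, map_sum, map_smul,
    InnerProductSpace.trace_rankOne, smul_eq_mul, ContinuousLinearMap.star_eq_adjoint,
    ContinuousLinearMap.adjoint_inner_left]
  exact Finset.sum_congr rfl fun i _ => Finset.sum_congr rfl fun j _ => mul_comm _ _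

/-- The von Neumann entropy `-tr (ρ log ρ)` of (the density operator of) a state, with the
logarithm given by the continuous functional calculus. -/
def vonNeumannEntropy (φ : (E →L[ℂ] E) →ₗ[ℂ] ℂ) : ℝ :=
  -(opTrace (densityOperator φ * CFC.log (densityOperator φ))).re

/-- The free energy `F(φ) = -T S(φ) + φ(h)`. -/
def freeEnergy (T : ℝ) (h : E →L[ℂ] E) (φ : (E →L[ℂ] E) →ₗ[ℂ] ℂ) : ℝ :=
  -T * vonNeumannEntropy φ + (φ h).re

/-- The evolved functional `ω_t = ω ∘ exp (t L)`. -/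
def evolved (L : (E →L[ℂ] E) →L[ℂ] (E →L[ℂ] E)) (φ : (E →L[ℂ] E) →ₗ[ℂ] ℂ) (t : ℝ) :
    (E →L[ℂ] E) →ₗ[ℂ] ℂ :=
  φ ∘ₗ (NormedSpace.exp ((t : ℂ) • L) : (E →L[ℂ] E) →L[ℂ] (E →L[ℂ] E)).toLinearMap

/-- Restricted thermodynamic stability of `(ω, h)` at temperature `T` with respect to `b`: along
every Lindbladian evolution built from `b`, the free energy has nonnegative derivative at `t = 0`.
(The existence of the derivative is automatic for faithful `ω`; it is written out so that no
default value of the derivative enters.) -/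
def RTS (ω : FaithfulState E) (h : E →L[ℂ] E) (T : ℝ) {r : ℕ} (b : Fin r → (E →L[ℂ] E)) : Prop :=
  ∀ M Λ : Matrix (Fin r) (Fin r) ℂ, M.conjTranspose = -M → Λ.PosSemidef →
    ∃ d : ℝ, HasDerivAt
      (fun t : ℝ => freeEnergy T h (evolved (lindbladian b M Λ) ω.toFunctional t)) d 0 ∧ 0 ≤ d

end FreeEnergy

namespace FaithfulState

theorem functional_star_mul (ω : FaithfulState E) (a b : E →L[ℂ] E) :
    (starRingEnd ℂ) (ω.toFunctional (star b * a)) = ω.toFunctional (star a * b) := by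
  have h1 := (Complex.le_def.1 (ω.nonneg' (a + b))).2
  have h2 := (Complex.le_def.1 (ω.nonneg' (a + Complex.I • b))).2
  have ha := (Complex.le_def.1 (ω.nonneg' a)).2
  have hb := (Complex.le_def.1 (ω.nonneg' b)).2
  simp only [star_add, star_smul, add_mul, mul_add, map_add, smul_mul_assoc, mul_smul_comm,
    map_smul, smul_eq_mul, Complex.star_def, Complex.conj_I, Complex.zero_im, Complex.add_im,
    Complex.mul_im, Complex.neg_im, Complex.neg_re, Complex.I_re, Complex.I_im,
    Complex.mul_re] at h1 h2 ha hb
  apply Complex.ext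
  · simp only [Complex.conj_re]; linarith
  · simp only [Complex.conj_im]; linarith

/-- The GNS space of a faithful state: the vector space of operators, to be given the inner product
`⟨a|b⟩ = ω (a* b)`. -/
@[nolint unusedArguments]
def GNSSpace (_ω : FaithfulState E) : Type _ := E →L[ℂ] E

variable (ω : FaithfulState E)

instance : AddCommGroup ω.GNSSpace := inferInstanceAs (AddCommGroup (E →L[ℂ] E))
instance : Module ℂ ω.GNSSpace := inferInstanceAs (Module ℂ (E →L[ℂ] E))

/-- The map `a ↦ |a⟩` from operators to GNS vectors. -/
def ket : (E →L[ℂ] E) ≃ₗ[ℂ] ω.GNSSpace := LinearEquiv.refl ℂ (E →L[ℂ] E)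

/-- The inner product `⟨a|b⟩ = ω (a* b)` on the GNS space. -/
@[reducible]
def gnsCore : InnerProductSpace.Core ℂ ω.GNSSpace where
  inner x y := ω.toFunctional (star (ω.ket.symm x) * ω.ket.symm y)
  conj_inner_symm x y := ω.functional_star_mul _ _
  re_inner_nonneg x := (Complex.le_def.1 (ω.nonneg' (ω.ket.symm x))).1
  add_left x y z := by simp only [map_add, star_add, add_mul]
  smul_left x y c := by simp only [map_smul, star_smul, smul_mul_assoc, smul_eq_mul]; rfl
  definite x hx := (LinearEquiv.map_eq_zero_iff ω.ket.symm).1 (ω.faithful' _ hx)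

instance : NormedAddCommGroup ω.GNSSpace :=
  InnerProductSpace.Core.toNormedAddCommGroup (cd := ω.gnsCore)

instance : InnerProductSpace ℂ ω.GNSSpace :=
  InnerProductSpace.ofCore ω.gnsCore.toCore

theorem inner_ket (a b : E →L[ℂ] E) :
    inner ℂ (ω.ket a) (ω.ket b) = ω.toFunctional (star a * b) := rfl

variable [FiniteDimensional ℂ E]

instance : FiniteDimensional ℂ ω.GNSSpace := Module.Finite.equiv ω.ket

instance : CompleteSpace ω.GNSSpace := FiniteDimensional.complete ℂ ω.GNSSpace

/-- The left representation `π_ℓ(a) |b⟩ = |a b⟩`. -/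
def leftRep (a : E →L[ℂ] E) : ω.GNSSpace →L[ℂ] ω.GNSSpace :=
  LinearMap.toContinuousLinearMap
    (ω.ket.toLinearMap ∘ₗ LinearMap.mulLeft ℂ a ∘ₗ ω.ket.symm.toLinearMap)

/-- The right representation `π_r(a) |b⟩ = |b a*⟩`. -/
def rightRep (a : E →L[ℂ] E) : ω.GNSSpace →L[ℂ] ω.GNSSpace :=
  LinearMap.toContinuousLinearMap
    (ω.ket.toLinearMap ∘ₗ LinearMap.mulRight ℂ (star a) ∘ₗ ω.ket.symm.toLinearMap)

theorem leftRep_ket (a b : E →L[ℂ] E) : ω.leftRep a (ω.ket b) = ω.ket (a * b) := rfl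

theorem rightRep_ket (a b : E →L[ℂ] E) : ω.rightRep a (ω.ket b) = ω.ket (b * star a) := rfl

/-- The GNS Hamiltonian `H = π_ℓ(h) - π_r(h)`. -/
def gnsHamiltonian (h : E →L[ℂ] E) : ω.GNSSpace →L[ℂ] ω.GNSSpace := ω.leftRep h - ω.rightRep h

/-- The linear functional `|a⟩ ↦ ω (a b*)`, where `x = |b⟩`. -/
def modularFunctional (x : ω.GNSSpace) : ω.GNSSpace →L[ℂ] ℂ :=
  LinearMap.toContinuousLinearMap
    (ω.toFunctional ∘ₗ LinearMap.mulRight ℂ (star (ω.ket.symm x)) ∘ₗ ω.ket.symm.toLinearMap)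

/-- The modular operator `Δ`: the operator on the GNS space that represents the sesquilinear form
`(a, b) ↦ ω (b a*)`, that is `⟨a|Δ|b⟩ = ω (b a*)` (see `inner_modularOperator`). The vector `Δ|b⟩` is
the Riesz representative of `|a⟩ ↦ ω (a b*)`. -/
def modularOperator : ω.GNSSpace →L[ℂ] ω.GNSSpace :=
  LinearMap.toContinuousLinearMap
    { toFun := fun x => (InnerProductSpace.toDual ℂ ω.GNSSpace).symm (ω.modularFunctional x)
      map_add' := fun x y => by
        rw [← map_add]
        congr 1
        ext z
        simp [modularFunctional, mul_add]
      map_smul' := fun c x => by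
        have h : ω.modularFunctional (c • x) = (starRingEnd ℂ) c • ω.modularFunctional x := by
          ext z
          simp [modularFunctional]
        rw [h, LinearIsometryEquiv.map_smulₛₗ]
        simp }

theorem inner_modularOperator (a b : E →L[ℂ] E) :
    inner ℂ (ω.ket a) (ω.modularOperator (ω.ket b)) = ω.toFunctional (b * star a) := by
  have h : inner ℂ (ω.modularOperator (ω.ket b)) (ω.ket a) = ω.toFunctional (a * star b) :=
    InnerProductSpace.toDual_symm_apply
  rw [← inner_conj_symm, h]
  simpa using ω.functional_star_mul (star b) (star a)

/-- The modular flow `t ↦ Δ^{it} = exp (i t log Δ)`. -/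
def modularFlow (t : ℝ) : ω.GNSSpace →L[ℂ] ω.GNSSpace :=
  NormedSpace.exp ((t * Complex.I : ℂ) • CFC.log ω.modularOperator)

/-- The span of `|b 1⟩, …, |b r⟩` in the GNS space. -/
def ketSpan {r : ℕ} (b : Fin r → (E →L[ℂ] E)) : Submodule ℂ ω.GNSSpace :=
  Submodule.span ℂ (Set.range fun i => ω.ket (b i))

/-- The span of the `|b i⟩` is mapped into itself by every `Δ^{it}`. -/
def ModularInvariant {r : ℕ} (b : Fin r → (E →L[ℂ] E)) : Prop :=
  ∀ t : ℝ, ∀ v ∈ ω.ketSpan b, ω.modularFlow t v ∈ ω.ketSpan b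

/-- The compression `P X P†` of `X` to a subspace `K`, where `P` is the orthogonal projection of
the GNS space onto `K` and its adjoint `P†` is the inclusion of `K`. -/
def compression (K : Submodule ℂ ω.GNSSpace) (X : ω.GNSSpace →L[ℂ] ω.GNSSpace) : K →L[ℂ] K :=
  K.orthogonalProjectionOnto ∘L X ∘L K.orthogonalProjectionOnto.adjoint

/-- The matrix of the compression `P X P†` in an orthonormal basis of the subspace. -/
def compressedMatrix {m : ℕ} {K : Submodule ℂ ω.GNSSpace} (a : OrthonormalBasis (Fin m) ℂ K)
    (X : ω.GNSSpace →L[ℂ] ω.GNSSpace) : Matrix (Fin m) (Fin m) ℂ :=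
  LinearMap.toMatrixOrthonormal a (ω.compression K X).toLinearMap

/-- The entries of the compressed matrix are `⟨a i|X|a j⟩`. -/
theorem compressedMatrix_apply {m : ℕ} {K : Submodule ℂ ω.GNSSpace}
    (a : OrthonormalBasis (Fin m) ℂ K) (X : ω.GNSSpace →L[ℂ] ω.GNSSpace) (i j : Fin m) :
    ω.compressedMatrix a X i j = inner ℂ (a i : ω.GNSSpace) (X (a j : ω.GNSSpace)) := by
  simp [compressedMatrix, compression, LinearMap.toMatrixOrthonormal_apply_apply,
    Submodule.adjoint_orthogonalProjectionOnto]

end FaithfulState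
end

/-!
The free energy has an explicit first variation: for a generator `L` with `L 1 = 0` that commutes
with the adjoint, its derivative along `ω ∘ exp (t L)` at `t = 0` is `ω (L X)` with
`X = T log ρ + h`, where `ρ` is the density operator of `ω` (`hasDerivAt_freeEnergy`). The only
analytic input is that the second-order remainder of `tr (B log B)` at `ρ` is a relative entropy,
which is quadratically small (`abs_trace_mul_log_remainder_le`).

The modular operator acts as `Δ|c⟩ = |ρ c ρ⁻¹⟩`, so `log Δ|c⟩ = |[log ρ, c]⟩`
(`FaithfulState.log_modularOperator_ket`), and `T log Δ + H` sends `|c⟩` to `|[X, c]⟩`. With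
`G i j = ⟨b i|T log Δ + H|b j⟩ = ω (bᵢ* [X, bⱼ])`, the matrix `M` pairs in `ω (L X)` with the
anti-Hermitian part of `G` and `Λ` with its Hermitian part. Hence restricted thermodynamic stability
is equivalent to positivity of the compression `P (T log Δ + H) P†` to the span `K` of the `|b i⟩`
(`FaithfulState.rts_iff_isPositive_compression`).

It remains to compare `P (log Δ) P†` with `log (P Δ P†)`. In general the former is at most the
latter, by the operator Jensen inequality for the logarithm
(`inner_log_le_inner_log_compression`). If `K` is invariant under the modular flow, hence under its
generator `log Δ`, the two agree (`FaithfulState.compression_log_of_invariant`).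
-/

/-! ### Functional calculus and Jensen's inequality in finite dimension -/

section Spectral

variable {H : Type*} [NormedAddCommGroup H] [InnerProductSpace ℂ H] [FiniteDimensional ℂ H]
  [CompleteSpace H]

theorem exists_eigenbasis (A : H →L[ℂ] H) (hA : IsSelfAdjoint A) :
    ∃ (e : OrthonormalBasis (Fin (Module.finrank ℂ H)) ℂ H) (l : Fin (Module.finrank ℂ H) → ℝ),
      ∀ i, A (e i) = (l i : ℂ) • e i :=
  ⟨hA.isSymmetric.eigenvectorBasis rfl, hA.isSymmetric.eigenvalues rfl,
    hA.isSymmetric.apply_eigenvectorBasis rfl⟩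

theorem finite_real_spectrum_clm (A : H →L[ℂ] H) : (spectrum ℝ A).Finite := by
  have h : (spectrum ℂ A).Finite := by
    rw [ContinuousLinearMap.spectrum_eq]
    exact Module.End.finite_spectrum (A : H →ₗ[ℂ] H)
  rw [← spectrum.preimage_algebraMap ℂ]
  exact h.preimage (FaithfulSMul.algebraMap_injective ℝ ℂ).injOn

open Polynomial in
/-- Every function agrees with a polynomial on a finite set; hence the continuous functional
calculus at an element with finite spectrum is evaluation of a polynomial. -/
theorem exists_polynomial_eqOn {s : Set ℝ} (hs : s.Finite) (f : ℝ → ℝ) :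
    ∃ p : ℝ[X], s.EqOn f p.eval := by
  classical
  refine ⟨Lagrange.interpolate hs.toFinset id f, fun x hx => ?_⟩
  exact (Lagrange.eval_interpolate_at_node f (v := id) Function.injective_id.injOn
    (hs.mem_toFinset.2 hx)).symm

theorem cfc_apply_of_eigenvector (A : H →L[ℂ] H) (hA : IsSelfAdjoint A) (f : ℝ → ℝ) {v : H} {l : ℝ}
    (h : A v = (l : ℂ) • v) : cfc f A v = (f l : ℂ) • v := by
  rcases eq_or_ne v 0 with rfl | hv
  · simp
  have hl : l ∈ spectrum ℝ A := by
    rw [← spectrum.preimage_algebraMap ℂ, Set.mem_preimage, ContinuousLinearMap.spectrum_eq]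
    exact (Module.End.hasEigenvalue_of_hasEigenvector
      (f := (A : H →ₗ[ℂ] H)) ⟨Module.End.mem_eigenspace_iff.2 h, hv⟩).mem_spectrum
  obtain ⟨p, hp⟩ := exists_polynomial_eqOn (finite_real_spectrum_clm A) f
  rw [cfc_congr hp, hp hl, cfc_polynomial p A]
  clear hp
  induction p using Polynomial.induction_on' with
  | add p q hp hq => simp [hp, hq, add_smul]
  | monomial n c =>
    have hn : (A ^ n) v = ((l : ℂ) ^ n) • v := by
      induction n with
      | zero => simp
      | succ n ih => rw [pow_succ', mul_apply_eq_comp, ih, map_smul, h, smul_smul,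
          pow_succ]
    rw [Polynomial.aeval_monomial, ← Algebra.smul_def, smul_apply, hn,
      RCLike.real_smul_eq_coe_smul (K := ℂ), smul_smul]
    simp

omit [FiniteDimensional ℂ H] in
theorem inner_apply_of_eigenvector {A : H →L[ℂ] H} (hA : IsSelfAdjoint A) {v : H} {l : ℝ}
    (h : A v = (l : ℂ) • v) (w : H) : inner ℂ v (A w) = (l : ℂ) * inner ℂ v w := by
  rw [← ContinuousLinearMap.adjoint_inner_left, hA.adjoint_eq, h, inner_smul_left,
    Complex.conj_ofReal]

/-- The continuous functional calculus commutes with passing to the matrix in an orthonormal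
basis. -/
theorem cfc_toMatrixOrthonormal {m : ℕ} (a : OrthonormalBasis (Fin m) ℂ H) (f : ℝ → ℝ)
    (A : H →L[ℂ] H) (hA : IsSelfAdjoint A) :
    cfc f (LinearMap.toMatrixOrthonormal a A.toLinearMap) =
      LinearMap.toMatrixOrthonormal a (cfc f A).toLinearMap := by
  let Φ : (H →L[ℂ] H) ≃ₐ[ℂ] Matrix (Fin m) (Fin m) ℂ :=
    (Module.End.toContinuousLinearMap H).symm.trans
      (LinearMap.toMatrixOrthonormal a).toAlgEquiv
  have hΦ (X : H →L[ℂ] H) : LinearMap.toMatrixOrthonormal a X.toLinearMap = Φ X := rfl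
  have hsa : IsSelfAdjoint (Φ A) := by
    have h : IsSelfAdjoint A.toLinearMap :=
      (LinearMap.isSymmetric_iff_isSelfAdjoint _).1 hA.isSymmetric
    exact h.map (LinearMap.toMatrixOrthonormal a)
  obtain ⟨p, hp⟩ := exists_polynomial_eqOn (finite_real_spectrum_clm A) f
  have hspec : spectrum ℝ (Φ A) = spectrum ℝ A := AlgEquiv.spectrum_eq (Φ.restrictScalars ℝ) A
  rw [hΦ, hΦ, cfc_congr hp, cfc_congr (hspec ▸ hp : (spectrum ℝ (Φ A)).EqOn f p.eval),
    cfc_polynomial p A, cfc_polynomial p (Φ A)]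
  exact Polynomial.aeval_algHom_apply (Φ.restrictScalars ℝ).toAlgHom A p

theorem inner_cfc_eigenbasis {ι : Type*} [Fintype ι] (e : OrthonormalBasis ι ℂ H) {l : ι → ℝ}
    (A : H →L[ℂ] H) (hA : IsSelfAdjoint A) (he : ∀ i, A (e i) = (l i : ℂ) • e i) (f : ℝ → ℝ)
    (v : H) :
    inner ℂ v (cfc f A v) = ((∑ i, f (l i) * ‖inner ℂ (e i) v‖ ^ 2 : ℝ) : ℂ) := by
  conv_lhs => rw [← e.sum_repr' v, map_sum]
  simp only [map_smul, cfc_apply_of_eigenvector A hA f (he _), inner_sum, inner_smul_right]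
  push_cast
  refine Finset.sum_congr rfl fun i _ => ?_
  rw [e.sum_repr' v, ← inner_conj_symm v (e i)]
  rw [← Complex.mul_conj']
  ring

omit [FiniteDimensional ℂ H] [CompleteSpace H] in
theorem eigenvalue_pos_of_inner_pos {A : H →L[ℂ] H} (hpos : ∀ x ≠ 0, 0 < (inner ℂ x (A x)).re)
    {v : H} (hv : ‖v‖ = 1) {l : ℝ} (h : A v = (l : ℂ) • v) : 0 < l := by
  have h1 := hpos v (norm_ne_zero_iff.1 (by simp [hv]))
  simpa [h, inner_smul_right, inner_self_eq_norm_sq_to_K, hv] using h1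

/-- The logarithm of a positive real is determined by resolvents: a comparison of the functions
`s ↦ ∑ w i / (x i + s)` gives the reversed comparison of `∑ w i * log (x i)`. The difference of
`∑ w i * log (x i + s)` has a derivative of constant sign and tends to zero at infinity. -/
theorem sum_mul_log_le_of_resolvent_le {ι κ : Type*} [Fintype ι] [Fintype κ] {w l : ι → ℝ}
    {w' l' : κ → ℝ} (hl : ∀ i, 0 < l i) (hl' : ∀ k, 0 < l' k) (hw : ∑ i, w i = ∑ k, w' k)
    (hs : ∀ s : ℝ, 0 ≤ s → ∑ k, (l' k + s)⁻¹ * w' k ≤ ∑ i, (l i + s)⁻¹ * w i) :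
    ∑ i, Real.log (l i) * w i ≤ ∑ k, Real.log (l' k) * w' k := by
  set φ : ℝ → ℝ := fun s => ∑ k, Real.log (s + l' k) * w' k - ∑ i, Real.log (s + l i) * w i with hφ
  have hderiv : ∀ s : ℝ, 0 ≤ s → HasDerivAt φ
      (∑ k, (l' k + s)⁻¹ * w' k - ∑ i, (l i + s)⁻¹ * w i) s := by
    intro s hs0
    refine HasDerivAt.sub (HasDerivAt.fun_sum fun k _ => ?_) (HasDerivAt.fun_sum fun i _ => ?_)
    · have h := ((hasDerivAt_id s).add_const (l' k)).log (by have := hl' k; simp; positivity)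
      simpa [add_comm, one_div] using h.mul_const (w' k)
    · have h := ((hasDerivAt_id s).add_const (l i)).log (by have := hl i; simp; positivity)
      simpa [add_comm, one_div] using h.mul_const (w i)
  have hanti : AntitoneOn φ (Set.Ici 0) := by
    refine antitoneOn_of_hasDerivWithinAt_nonpos (convex_Ici 0)
      (fun s h => (hderiv s h).continuousAt.continuousWithinAt)
      (fun s h => (hderiv s (interior_subset h)).hasDerivWithinAt) fun s h => ?_
    linarith [hs s (interior_subset h)]
  have hlim : Filter.Tendsto φ Filter.atTop (nhds 0) := by
    have h1 : Filter.Tendsto (fun s : ℝ =>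
        ∑ k, (Real.log (s + l' k) - Real.log s) * w' k
          - ∑ i, (Real.log (s + l i) - Real.log s) * w i) Filter.atTop
        (nhds (∑ k, 0 * w' k - ∑ i, 0 * w i)) :=
      (tendsto_finsetSum _ fun k _ =>
        (Real.tendsto_log_comp_add_sub_log (l' k)).mul_const _).sub
        (tendsto_finsetSum _ fun i _ =>
          (Real.tendsto_log_comp_add_sub_log (l i)).mul_const _)
    simp only [zero_mul, Finset.sum_const_zero, sub_zero] at h1
    refine h1.congr fun s => ?_
    simp only [hφ, sub_mul, Finset.sum_sub_distrib, ← Finset.mul_sum, hw]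
    ring
  have h0 : 0 ≤ φ 0 := by
    refine le_of_tendsto hlim ?_
    filter_upwards [Filter.eventually_ge_atTop 0] with s hs0
    exact hanti Set.self_mem_Ici hs0 hs0
  simpa [hφ] using h0

/-- The functional calculus at `x ↦ (x + s)⁻¹` is a right inverse of `A + s`. -/
theorem resolvent_apply (A : H →L[ℂ] H) (hA : IsSelfAdjoint A)
    (hpos : ∀ x ≠ 0, 0 < (inner ℂ x (A x)).re) {s : ℝ} (hs : 0 ≤ s) (v : H) :
    A (cfc (fun x : ℝ => (x + s)⁻¹) A v) + (s : ℂ) • cfc (fun x : ℝ => (x + s)⁻¹) A v = v := by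
  obtain ⟨e, l, he⟩ := exists_eigenbasis A hA
  set R := cfc (fun x : ℝ => (x + s)⁻¹) A with hR
  have h : (A ∘L R + (s : ℂ) • R : H →L[ℂ] H).toLinearMap = LinearMap.id := by
    refine e.toBasis.ext fun i => ?_
    have hl := eigenvalue_pos_of_inner_pos hpos (e.norm_eq_one i) (he i)
    have hne : ((l i : ℂ) + s) ≠ 0 := by
      exact_mod_cast (by positivity : (l i + s) ≠ 0)
    have hRe := cfc_apply_of_eigenvector A hA (fun x : ℝ => (x + s)⁻¹) (he i)
    simp only [OrthonormalBasis.coe_toBasis, ContinuousLinearMap.coe_coe, add_apply,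
      ContinuousLinearMap.comp_apply, smul_apply, LinearMap.id_apply]
    rw [hR, hRe, map_smul, he i, smul_smul, smul_smul, ← add_smul]
    push_cast
    rw [show ((l i : ℂ) + s)⁻¹ * l i + s * ((l i : ℂ) + s)⁻¹ = 1 by field_simp, one_smul]
  exact LinearMap.congr_fun h v

-- The C⋆-algebra of operators on a subspace is found only with a deeper instance search.
set_option maxSynthPendingDepth 4 in
/-- Operator Jensen inequality for the logarithm: the compression of `log A` to a subspace is at
most the logarithm of the compression `B` of `A`. It follows from the corresponding inequality for
resolvents, which is positivity of the form `⟨z, (A + s) z⟩` at the difference `z` of the two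
resolvent vectors. -/
theorem inner_log_le_inner_log_compression (A : H →L[ℂ] H) (hA : IsSelfAdjoint A)
    (hpos : ∀ x ≠ 0, 0 < (inner ℂ x (A x)).re) (K : Submodule ℂ H) [CompleteSpace K] (B : K →L[ℂ] K)
    (hB : IsSelfAdjoint B) (hAB : ∀ x y : K, inner ℂ (x : H) (A y) = inner ℂ x (B y)) (v : K) :
    (inner ℂ (v : H) (CFC.log A v)).re ≤ (inner ℂ v (CFC.log B v)).re := by
  have hposB : ∀ x ≠ 0, 0 < (inner ℂ x (B x)).re := fun x hx => by
    rw [← hAB]; exact hpos x (by simpa using hx)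
  obtain ⟨e, l, he⟩ := exists_eigenbasis A hA
  obtain ⟨u, μ, hu⟩ := exists_eigenbasis B hB
  rw [CFC.log, CFC.log, inner_cfc_eigenbasis e A hA he, inner_cfc_eigenbasis u B hB hu,
    Complex.ofReal_re, Complex.ofReal_re]
  refine sum_mul_log_le_of_resolvent_le
    (fun i => eigenvalue_pos_of_inner_pos hpos (e.norm_eq_one i) (he i))
    (fun i => eigenvalue_pos_of_inner_pos hposB (u.norm_eq_one i) (hu i)) ?_ ?_
  · rw [e.sum_sq_norm_inner_right, u.sum_sq_norm_inner_right, Submodule.coe_norm]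
  intro s hs
  have hx := resolvent_apply B hB hposB hs v
  have hy := resolvent_apply A hA hpos hs (v : H)
  have hxv := congrArg Complex.re
    (inner_cfc_eigenbasis u B hB hu (fun x : ℝ => (x + s)⁻¹) v)
  have hyv := congrArg Complex.re
    (inner_cfc_eigenbasis e A hA he (fun x : ℝ => (x + s)⁻¹) (v : H))
  rw [Complex.ofReal_re] at hxv hyv
  rw [← hxv, ← hyv]
  set x := cfc (fun x : ℝ => (x + s)⁻¹) B v
  set y := cfc (fun x : ℝ => (x + s)⁻¹) A (v : H)
  -- positivity of the form `⟨z, (A + s) z⟩` at `z = y - x`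
  have hz : 0 ≤ (inner ℂ (y - x : H) (A (y - x) + (s : ℂ) • (y - x : H))).re := by
    rcases eq_or_ne (y - x : H) 0 with h0 | h0
    · simp [h0]
    rw [inner_add_right, inner_smul_right, Complex.add_re, inner_self_eq_norm_sq_to_K]
    have h1 := hpos _ h0
    have h2 : 0 ≤ s * ‖(y - x : H)‖ ^ 2 := by positivity
    have h3 : ((s : ℂ) * ((‖(y - x : H)‖ : ℝ) : ℂ) ^ 2).re = s * ‖(y - x : H)‖ ^ 2 := by
      norm_cast
    exact add_nonneg h1.le (h3 ▸ h2)
  have hyx : inner ℂ y (A x + (s : ℂ) • (x : H)) = inner ℂ (v : H) (x : H) := by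
    conv_rhs => rw [← hy]
    rw [inner_add_left, inner_add_right, inner_smul_left, inner_smul_right,
      ← ContinuousLinearMap.adjoint_inner_left, hA.adjoint_eq]
    simp
  have hxx : inner ℂ (x : H) (A x + (s : ℂ) • (x : H)) = inner ℂ (x : H) (v : H) := by
    rw [inner_add_right, hAB, inner_smul_right, ← Submodule.coe_inner, ← Submodule.coe_inner,
      ← inner_smul_right, ← inner_add_right, hx]
  have hsplit : A (y - x) + (s : ℂ) • (y - x : H) = v - (A x + (s : ℂ) • (x : H)) := by
    rw [map_sub, smul_sub, sub_add_sub_comm, hy]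
  rw [hsplit, inner_sub_left, inner_sub_right, inner_sub_right, hyx, hxx, sub_self, sub_zero,
    Complex.sub_re] at hz
  have hc : (inner ℂ y (v : H)).re = (inner ℂ (v : H) y).re := by
    rw [← inner_conj_symm, Complex.conj_re]
  rw [Submodule.coe_inner]
  linarith

end Spectral

/-! ### First-order expansion of the entropy -/

section Entropy

variable {E : Type*} [NormedAddCommGroup E] [InnerProductSpace ℂ E] [CompleteSpace E]
  [FiniteDimensional ℂ E]

omit [CompleteSpace E] [FiniteDimensional ℂ E] in
theorem opTrace_sub (a b : E →L[ℂ] E) : opTrace (a - b) = opTrace a - opTrace b := by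
  simp [opTrace]

omit [CompleteSpace E] [FiniteDimensional ℂ E] in
theorem opTrace_mul_comm (a b : E →L[ℂ] E) : opTrace (a * b) = opTrace (b * a) :=
  LinearMap.trace_mul_comm ℂ (a : E →ₗ[ℂ] E) (b : E →ₗ[ℂ] E)

omit [CompleteSpace E] [FiniteDimensional ℂ E] in
theorem opTrace_mul_of_eigenbasis {ι κ : Type*} [Fintype ι] [Fintype κ]
    (e : OrthonormalBasis ι ℂ E) (u : OrthonormalBasis κ ℂ E) {F G : E →L[ℂ] E} {f : ι → ℝ}
    {g : κ → ℝ} (hF : ∀ i, F (e i) = (f i : ℂ) • e i) (hG : ∀ k, G (u k) = (g k : ℂ) • u k) :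
    (opTrace (F * G)).re = ∑ k, ∑ i, f i * g k * ‖inner ℂ (e i) (u k)‖ ^ 2 := by
  have h : opTrace (F * G) = ((∑ k, ∑ i, f i * g k * ‖inner ℂ (e i) (u k)‖ ^ 2 : ℝ) : ℂ) := by
    rw [opTrace, LinearMap.trace_eq_sum_inner _ u]
    push_cast
    refine Finset.sum_congr rfl fun k _ => ?_
    have hFu : F (u k) = ∑ i, (inner ℂ (e i) (u k) * f i) • e i := by
      conv_lhs => rw [← e.sum_repr' (u k), map_sum]
      simp only [map_smul, hF, smul_smul]
    rw [Module.End.mul_apply, ContinuousLinearMap.coe_coe, ContinuousLinearMap.coe_coe, hG,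
      map_smul, hFu, inner_smul_right,
      inner_sum, Finset.mul_sum]
    refine Finset.sum_congr rfl fun i _ => ?_
    rw [inner_smul_right, ← inner_conj_symm (u k) (e i), ← Complex.mul_conj']
    ring
  rw [h, Complex.ofReal_re]

/-- Bounds for the second-order remainder of `x ↦ x log x` at `y`, from `log z ≤ z - 1` at
`z = x / y` and `z = y / x`. -/
theorem relEntropy_term_bounds {x y c : ℝ} (hx : 0 ≤ x) (hc : 0 < c) (hy : c ≤ y) :
    0 ≤ x * Real.log x - Real.log y * x - x + y ∧
      x * Real.log x - Real.log y * x - x + y ≤ c⁻¹ * (x - y) ^ 2 := by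
  have hy0 : 0 < y := hc.trans_le hy
  have key : x * Real.log x - Real.log y * x - x + y ≤ (x - y) ^ 2 / y ∧
      0 ≤ x * Real.log x - Real.log y * x - x + y := by
    rcases hx.eq_or_lt with rfl | hx
    · constructor
      · field_simp; simp [sq]
      · simpa using hy0.le
    · have h1 := Real.log_le_sub_one_of_pos (div_pos hx hy0)
      have h2 := Real.log_le_sub_one_of_pos (div_pos hy0 hx)
      rw [Real.log_div hx.ne' hy0.ne'] at h1
      rw [Real.log_div hy0.ne' hx.ne'] at h2
      have h3 := mul_le_mul_of_nonneg_left h1 hx.le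
      have h4 := mul_le_mul_of_nonneg_left h2 hx.le
      have h5 : x * (y / x - 1) = y - x := by field_simp
      have h6 : x * (x / y - 1) = (x - y) ^ 2 / y + (x - y) := by field_simp; ring
      constructor <;> nlinarith
  refine ⟨key.2, key.1.trans ?_⟩
  rw [div_eq_inv_mul]
  gcongr

/-- The second-order remainder of `B ↦ tr (B log B)` at a positive definite `A` is the relative
entropy of `B` with respect to `A`. In eigenbases of `A` and `B` it becomes a sum of scalar
remainders, which are nonnegative and quadratically small. -/
theorem abs_trace_mul_log_remainder_le {A B : E →L[ℂ] E} (hA : IsSelfAdjoint A)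
    (hB : IsSelfAdjoint B) {c : ℝ} (hc : 0 < c)
    (hAc : ∀ x : E, c * ‖x‖ ^ 2 ≤ (inner ℂ x (A x)).re) (hB0 : ∀ x, 0 ≤ (inner ℂ x (B x)).re) :
    |(opTrace (B * CFC.log B)).re - (opTrace (A * CFC.log A)).re
        - (opTrace ((B - A) * CFC.log A)).re - (opTrace (B - A)).re| ≤
      c⁻¹ * (opTrace ((B - A) * (B - A))).re := by
  obtain ⟨e, l, he⟩ := exists_eigenbasis A hA
  obtain ⟨u, μ, hu⟩ := exists_eigenbasis B hB
  have hl (i) : c ≤ l i := by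
    simpa [he, inner_smul_right, inner_self_eq_norm_sq_to_K] using hAc (e i)
  have hμ (k) : 0 ≤ μ k := by
    simpa [hu, inner_smul_right, inner_self_eq_norm_sq_to_K] using hB0 (u k)
  have hlog (i) : CFC.log A (e i) = (Real.log (l i) : ℂ) • e i :=
    cfc_apply_of_eigenvector A hA _ (he i)
  have hlogB (k) : (B * CFC.log B) (u k) = ((μ k * Real.log (μ k) : ℝ) : ℂ) • u k := by
    rw [mul_apply_eq_comp, CFC.log, cfc_apply_of_eigenvector B hB _ (hu k), map_smul, hu, smul_smul]
    push_cast
    rw [mul_comm]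
  have hone {ι : Type} [Fintype ι] (e : OrthonormalBasis ι ℂ E) (i) :
    (1 : E →L[ℂ] E) (e i) = ((1 : ℝ) : ℂ) • e i := by simp
  have hsq {ι : Type} [Fintype ι] (e : OrthonormalBasis ι ℂ E) {A : E →L[ℂ] E} {l : ι → ℝ}
      (he : ∀ i, A (e i) = (l i : ℂ) • e i) (i) : (A * A) (e i) = ((l i ^ 2 : ℝ) : ℂ) • e i := by
    rw [mul_apply_eq_comp, he, map_smul, he, smul_smul]
    push_cast
    rw [sq]
  have t1 := opTrace_mul_of_eigenbasis e u (hone e) hlogB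
  have t2 := opTrace_mul_of_eigenbasis e u hlog hu
  have t3 := opTrace_mul_of_eigenbasis e u (hone e) hu
  have t4 := opTrace_mul_of_eigenbasis e u he (hone u)
  have t5 := opTrace_mul_of_eigenbasis e u (hone e) (hsq u hu)
  have t6 := opTrace_mul_of_eigenbasis e u he hu
  have t7 := opTrace_mul_of_eigenbasis e u (hsq e he) (hone u)
  rw [one_mul] at t1 t3 t5
  rw [mul_one] at t4 t7
  have hD : (opTrace (B * CFC.log B)).re - (opTrace (A * CFC.log A)).re
        - (opTrace ((B - A) * CFC.log A)).re - (opTrace (B - A)).re =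
      ∑ k, ∑ i, (μ k * Real.log (μ k) - Real.log (l i) * μ k - μ k + l i)
        * ‖inner ℂ (e i) (u k)‖ ^ 2 := by
    rw [sub_mul, opTrace_sub, opTrace_sub, opTrace_mul_comm B (CFC.log A), Complex.sub_re,
      Complex.sub_re, t1, t2, t3, t4]
    simp only [sub_mul, add_mul, Finset.sum_add_distrib, Finset.sum_sub_distrib, one_mul, mul_one]
    ring
  have hQ : (opTrace ((B - A) * (B - A))).re =
      ∑ k, ∑ i, (μ k - l i) ^ 2 * ‖inner ℂ (e i) (u k)‖ ^ 2 := by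
    rw [sub_mul, mul_sub, mul_sub, opTrace_sub, opTrace_sub, opTrace_sub, opTrace_mul_comm B A]
    simp only [Complex.sub_re]
    rw [t5, t6, t7]
    simp only [← Finset.sum_sub_distrib]
    refine Finset.sum_congr rfl fun k _ => Finset.sum_congr rfl fun i _ => ?_
    ring
  rw [hD, hQ, abs_of_nonneg, Finset.mul_sum]
  · refine Finset.sum_le_sum fun k _ => ?_
    rw [Finset.mul_sum]
    refine Finset.sum_le_sum fun i _ => ?_
    rw [← mul_assoc]
    exact mul_le_mul_of_nonneg_right (relEntropy_term_bounds (hμ k) hc (hl i)).2 (sq_nonneg _)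
  · exact Finset.sum_nonneg fun k _ => Finset.sum_nonneg fun i _ =>
      mul_nonneg (relEntropy_term_bounds (hμ k) hc (hl i)).1 (sq_nonneg _)

theorem exists_pos_mul_sq_norm_le {A : E →L[ℂ] E} (hA : IsSelfAdjoint A)
    (hpos : ∀ x ≠ 0, 0 < (inner ℂ x (A x)).re) :
    ∃ c : ℝ, 0 < c ∧ ∀ x : E, c * ‖x‖ ^ 2 ≤ (inner ℂ x (A x)).re := by
  obtain ⟨e, l, he⟩ := exists_eigenbasis A hA
  obtain ⟨c, hc, hcl⟩ : ∃ c : ℝ, 0 < c ∧ ∀ i, c ≤ l i := by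
    have hl := fun i => eigenvalue_pos_of_inner_pos hpos (e.norm_eq_one i) (he i)
    rcases isEmpty_or_nonempty (Fin (Module.finrank ℂ E)) with h | h
    · exact ⟨1, one_pos, fun i => h.elim i⟩
    · obtain ⟨j, hj⟩ := Finite.exists_min l
      exact ⟨l j, hl j, hj⟩
  refine ⟨c, hc, fun x => ?_⟩
  have h := inner_cfc_eigenbasis e A hA he id x
  rw [cfc_id ℝ A] at h
  rw [h, Complex.ofReal_re, ← e.sum_sq_norm_inner_right x, Finset.mul_sum]
  exact Finset.sum_le_sum fun i _ => mul_le_mul_of_nonneg_right (hcl i) (sq_nonneg _)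

/-- Along a differentiable curve `B` of self-adjoint operators through a positive definite
operator, `tr (B log B)` agrees to first order with `tr (B log (B 0)) + tr B`. -/
theorem hasDerivAt_trace_mul_log {B : ℝ → E →L[ℂ] E} {B' : E →L[ℂ] E} (hB' : HasDerivAt B B' 0)
    (hB : ∀ t, IsSelfAdjoint (B t)) (hpos : ∀ x ≠ 0, 0 < (inner ℂ x (B 0 x)).re) :
    HasDerivAt (fun t => (opTrace (B t * CFC.log (B t))).re)
      ((opTrace (B' * CFC.log (B 0))).re + (opTrace B').re) 0 := by
  obtain ⟨c, hc, hAc⟩ := exists_pos_mul_sq_norm_le (hB 0) hpos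
  set A := B 0 with hA
  -- the real part of the trace as a continuous real-linear functional
  let τ : (E →L[ℂ] E) →L[ℝ] ℝ := Complex.reCLM ∘L
    ((LinearMap.toContinuousLinearMap (𝕜 := ℂ) (LinearMap.trace ℂ E ∘ₗ
      ContinuousLinearMap.coeLM ℂ)).restrictScalars ℝ)
  have hτ (a : E →L[ℂ] E) : τ a = (opTrace a).re := rfl
  have hlin : HasDerivAt (fun t => τ ((B t - A) * CFC.log A) + τ (B t - A))
      (τ (B' * CFC.log A) + τ B') 0 :=
    (τ.hasFDerivAt.comp_hasDerivAt 0 ((hB'.sub_const A).mul_const (CFC.log A))).add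
      (τ.hasFDerivAt.comp_hasDerivAt 0 (hB'.sub_const A))
  have hquad : HasDerivAt (fun t => c⁻¹ * τ ((B t - A) * (B t - A))) 0 0 := by
    have h := (τ.hasFDerivAt.comp_hasDerivAt 0 ((hB'.sub_const A).mul (hB'.sub_const A))).const_mul
      c⁻¹
    simpa [← hA] using h
  -- positive definiteness of `B 0` persists as positivity of `B t` for small `t` of either sign
  have hpos_ev : ∀ᶠ t in nhds 0, ∀ x, 0 ≤ (inner ℂ x (B t x)).re := by
    have h : ∀ᶠ t in nhds 0, dist (B t) A < c := hB'.continuousAt (Metric.ball_mem_nhds A hc)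
    filter_upwards [h] with t ht x
    have h1 : ‖inner ℂ x ((B t - A) x)‖ ≤ c * ‖x‖ ^ 2 := by
      calc ‖inner ℂ x ((B t - A) x)‖ ≤ ‖x‖ * (‖B t - A‖ * ‖x‖) :=
            (norm_inner_le_norm _ _).trans (by gcongr; exact (B t - A).le_opNorm x)
        _ = ‖B t - A‖ * ‖x‖ ^ 2 := by ring
        _ ≤ c * ‖x‖ ^ 2 := by
          gcongr
          rw [← dist_eq_norm]; exact ht.le
    have h2 := (abs_le.1 ((Complex.abs_re_le_norm _).trans h1)).1
    rw [sub_apply, inner_sub_right, Complex.sub_re] at h2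
    linarith [hAc x]
  have hrem : HasDerivAt (fun t => (opTrace (B t * CFC.log (B t))).re
      - (opTrace (A * CFC.log A)).re - (τ ((B t - A) * CFC.log A) + τ (B t - A))) 0 0 := by
    rw [hasDerivAt_iff_isLittleO] at hquad ⊢
    refine Asymptotics.IsBigO.trans_isLittleO (Asymptotics.IsBigO.of_bound 1 ?_) hquad
    filter_upwards [hpos_ev] with t ht
    have h := abs_trace_mul_log_remainder_le (hB 0) (hB t) hc hAc ht
    simp only [hτ, ← hA, sub_self, zero_mul, mul_zero, smul_zero, sub_zero, Real.norm_eq_abs,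
      one_mul, show opTrace (0 : E →L[ℂ] E) = 0 from by simp [opTrace], Complex.zero_re, add_zero]
    rw [sub_sub] at h
    exact h.trans (le_abs_self _)
  have h := (hrem.add hlin).add_const (opTrace (A * CFC.log A)).re
  rw [zero_add] at h
  refine h.congr_of_eventuallyEq (Filter.Eventually.of_forall fun t => ?_)
  simp

end Entropy

/-! ### First variation of the free energy -/

section FreeEnergyDerivative

theorem hasDerivAt_exp_smul_zero {𝔸 : Type*} [NormedRing 𝔸] [NormedAlgebra ℂ 𝔸] [CompleteSpace 𝔸]
    (x : 𝔸) : HasDerivAt (fun z : ℂ => NormedSpace.exp (z • x)) x 0 := by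
  simpa using hasDerivAt_exp_smul_const (𝕂 := ℂ) x 0

variable {E : Type*} [NormedAddCommGroup E] [InnerProductSpace ℂ E] [CompleteSpace E]

theorem lindbladian_one {r : ℕ} (b : Fin r → (E →L[ℂ] E)) (M Λ : Matrix (Fin r) (Fin r) ℂ) :
    lindbladian b M Λ 1 = 0 := by
  rw [lindbladian_apply]
  refine Finset.sum_eq_zero fun i _ => Finset.sum_eq_zero fun j _ => ?_
  simp only [mul_one, one_mul]
  module

theorem lindbladian_star {r : ℕ} (b : Fin r → (E →L[ℂ] E)) {M Λ : Matrix (Fin r) (Fin r) ℂ}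
    (hM : M.conjTranspose = -M) (hΛ : Λ.IsHermitian) (a : E →L[ℂ] E) :
    lindbladian b M Λ (star a) = star (lindbladian b M Λ a) := by
  rw [lindbladian_apply, lindbladian_apply, Finset.sum_comm]
  simp only [star_sum]
  refine Finset.sum_congr rfl fun i _ => Finset.sum_congr rfl fun j _ => ?_
  have hM' : (starRingEnd ℂ) (M i j) = -M j i := congrFun (congrFun hM j) i
  have hΛ' : (starRingEnd ℂ) (Λ i j) = Λ j i := hΛ.apply j i
  simp only [star_add, star_sub, star_smul, star_mul, star_star, RCLike.star_def, map_neg,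
    map_div₀, map_one, map_ofNat, hM', hΛ', mul_assoc]
  module

/-- The exponential of a `*`-preserving generator is `*`-preserving. -/
theorem exp_apply_star {L : (E →L[ℂ] E) →L[ℂ] (E →L[ℂ] E)} (hL : ∀ a, L (star a) = star (L a))
    (a : E →L[ℂ] E) : NormedSpace.exp L (star a) = star (NormedSpace.exp L a) := by
  have h (x : E →L[ℂ] E) : HasSum (fun n : ℕ => (n.factorial : ℂ)⁻¹ • (L ^ n) x)
      (NormedSpace.exp L x) :=
    (NormedSpace.exp_series_hasSum_exp' (𝕂 := ℂ) L).mapL (ContinuousLinearMap.apply ℂ _ x)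
  have hpow (n : ℕ) : (L ^ n) (star a) = star ((L ^ n) a) := by
    induction n with
    | zero => rfl
    | succ n ih => rw [pow_succ', mul_apply_eq_comp, mul_apply_eq_comp, ih, hL]
  have h2 := (h a).star
  simp only [star_smul, star_inv₀, star_natCast, ← hpow] at h2
  exact (h (star a)).unique h2

variable [FiniteDimensional ℂ E]

theorem isSelfAdjoint_densityOperator {φ : (E →L[ℂ] E) →ₗ[ℂ] ℂ}
    (hφ : ∀ a, φ (star a) = (starRingEnd ℂ) (φ a)) : IsSelfAdjoint (densityOperator φ) := by
  rw [IsSelfAdjoint, densityOperator, star_sum, Finset.sum_comm]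
  simp only [star_sum]
  refine Finset.sum_congr rfl fun i _ => Finset.sum_congr rfl fun j _ => ?_
  rw [star_smul, RCLike.star_def, ← hφ]
  simp [ContinuousLinearMap.star_eq_adjoint]

theorem inner_densityOperator (φ : (E →L[ℂ] E) →ₗ[ℂ] ℂ) (v : E) :
    inner ℂ v (densityOperator φ v) = φ (InnerProductSpace.rankOne ℂ v v) := by
  rw [← opTrace_densityOperator_mul]
  have h : densityOperator φ * InnerProductSpace.rankOne ℂ v v =
      InnerProductSpace.rankOne ℂ (densityOperator φ v) v := by
    ext w; simp
  rw [h, opTrace, InnerProductSpace.trace_rankOne]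

namespace FaithfulState

omit [FiniteDimensional ℂ E] in
theorem map_star (ω : FaithfulState E) (a : E →L[ℂ] E) :
    ω.toFunctional (star a) = (starRingEnd ℂ) (ω.toFunctional a) := by
  simpa using (ω.functional_star_mul a 1).symm

theorem isSelfAdjoint_densityOperator (ω : FaithfulState E) :
    IsSelfAdjoint (densityOperator ω.toFunctional) :=
  _root_.isSelfAdjoint_densityOperator ω.map_star

omit [FiniteDimensional ℂ E] in
theorem re_pos (ω : FaithfulState E) {a : E →L[ℂ] E} (ha : a ≠ 0) :
    0 < (ω.toFunctional (star a * a)).re := by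
  have h := Complex.le_def.1 (ω.nonneg' a)
  refine lt_of_le_of_ne h.1 fun h0 => ha (ω.faithful' a (Complex.ext h0.symm h.2.symm))

theorem inner_densityOperator_pos (ω : FaithfulState E) (x : E) (hx : x ≠ 0) :
    0 < (inner ℂ x (densityOperator ω.toFunctional x)).re := by
  have hne : InnerProductSpace.rankOne ℂ x x ≠ (0 : E →L[ℂ] E) := by
    intro h
    have := congrArg (fun f : E →L[ℂ] E => f x) h
    simp [hx] at this
  have h := ω.re_pos hne
  have hsq : star (InnerProductSpace.rankOne ℂ x x : E →L[ℂ] E) * InnerProductSpace.rankOne ℂ x x =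
      ((‖x‖ ^ 2 : ℝ) : ℂ) • InnerProductSpace.rankOne ℂ x x := by
    ext w
    simp [ContinuousLinearMap.star_eq_adjoint, inner_self_eq_norm_sq_to_K, smul_smul, mul_comm]
  rw [hsq, map_smul, smul_eq_mul, Complex.re_ofReal_mul] at h
  rw [inner_densityOperator]
  exact pos_of_mul_pos_right h (by positivity)

end FaithfulState

theorem hasDerivAt_evolved (L : (E →L[ℂ] E) →L[ℂ] (E →L[ℂ] E)) (φ : (E →L[ℂ] E) →ₗ[ℂ] ℂ)
    (x : E →L[ℂ] E) : HasDerivAt (fun t : ℝ => evolved L φ t x) (φ (L x)) 0 := by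
  have h1 : HasDerivAt (fun z : ℂ => NormedSpace.exp (z • L)) L 0 := hasDerivAt_exp_smul_zero L
  let ψ : ((E →L[ℂ] E) →L[ℂ] (E →L[ℂ] E)) →L[ℂ] ℂ :=
    (LinearMap.toContinuousLinearMap φ) ∘L (ContinuousLinearMap.apply ℂ (E →L[ℂ] E) x)
  have h2 := ψ.hasFDerivAt.comp_hasDerivAt 0 h1
  have h3 : HasDerivAt (fun z : ℂ => ψ (NormedSpace.exp (z • L))) (φ (L x)) ((0 : ℝ) : ℂ) := by
    rw [Complex.ofReal_zero]
    exact h2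
  exact h3.comp_ofReal

omit [FiniteDimensional ℂ E] in
theorem evolved_zero (L : (E →L[ℂ] E) →L[ℂ] (E →L[ℂ] E)) (φ : (E →L[ℂ] E) →ₗ[ℂ] ℂ) :
    evolved L φ 0 = φ := by
  have h0 : ((0 : ℝ) : ℂ) • L = 0 := ContinuousLinearMap.ext fun x => by simp
  have h : NormedSpace.exp (((0 : ℝ) : ℂ) • L) = 1 := by
    rw [h0, NormedSpace.exp_zero]
  rw [evolved, h]
  rfl

/-- First variation of the free energy: since `L 1 = 0`, the derivative is the expectation of
`L (T log ρ + h)`. -/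
theorem hasDerivAt_freeEnergy (ω : FaithfulState E) (h : E →L[ℂ] E) (T : ℝ)
    {L : (E →L[ℂ] E) →L[ℂ] (E →L[ℂ] E)} (hL1 : L 1 = 0) (hLs : ∀ a, L (star a) = star (L a)) :
    HasDerivAt (fun t : ℝ => freeEnergy T h (evolved L ω.toFunctional t))
      (ω.toFunctional (L ((T : ℂ) • CFC.log (densityOperator ω.toFunctional) + h))).re 0 := by
  set B : ℝ → E →L[ℂ] E := fun t => densityOperator (evolved L ω.toFunctional t) with hBdef
  have hB0 : B 0 = densityOperator ω.toFunctional := by rw [hBdef]; simp only [evolved_zero]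
  have hsa (t : ℝ) : IsSelfAdjoint (B t) := by
    refine _root_.isSelfAdjoint_densityOperator fun a => ?_
    have h1 : ∀ a, ((t : ℂ) • L) (star a) = star (((t : ℂ) • L) a) := fun a => by
      simp [hLs, star_smul]
    simp only [evolved, LinearMap.comp_apply, ContinuousLinearMap.coe_coe, exp_apply_star h1,
      ω.map_star]
  obtain ⟨B', hB', hB'tr⟩ : ∃ B', HasDerivAt B B' 0 ∧
      ∀ x, opTrace (B' * x) = ω.toFunctional (L x) := by
    refine ⟨densityOperator (ω.toFunctional ∘ₗ L.toLinearMap), ?_,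
      fun x => opTrace_densityOperator_mul _ x⟩
    exact HasDerivAt.fun_sum fun i _ => HasDerivAt.fun_sum fun j _ =>
      (hasDerivAt_evolved L ω.toFunctional _).smul_const _
  have hent := hasDerivAt_trace_mul_log hB' hsa (by rw [hB0]; exact ω.inner_densityOperator_pos)
  have hh : HasDerivAt (fun t : ℝ => (evolved L ω.toFunctional t h).re)
      (ω.toFunctional (L h)).re 0 :=
    Complex.reCLM.hasFDerivAt.comp_hasDerivAt 0 (hasDerivAt_evolved L ω.toFunctional h)
  have htr : opTrace B' = 0 := by simpa [hL1] using hB'tr 1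
  have hmain := (hent.const_mul T).add hh
  rw [hB0, hB'tr, htr, Complex.zero_re, add_zero] at hmain
  have hval : (ω.toFunctional (L ((T : ℂ) • CFC.log (densityOperator ω.toFunctional) + h))).re =
      T * (ω.toFunctional (L (CFC.log (densityOperator ω.toFunctional)))).re
        + (ω.toFunctional (L h)).re := by
    rw [map_add, map_smul, map_add, map_smul, smul_eq_mul, Complex.add_re, Complex.re_ofReal_mul]
  rw [hval]
  refine hmain.congr_of_eventuallyEq (Filter.Eventually.of_forall fun t => ?_)
  simp [freeEnergy, vonNeumannEntropy, hBdef]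

omit [FiniteDimensional ℂ E] in
/-- The first variation along a Lindbladian in terms of the Gram-type matrix
`G i j = ω (bᵢ* [X, bⱼ])`: the Hamiltonian part sees its anti-Hermitian part and the dissipative
part its Hermitian part. -/
theorem FaithfulState.apply_lindbladian (ω : FaithfulState E) {X : E →L[ℂ] E}
    (hX : IsSelfAdjoint X) {r : ℕ} (b : Fin r → (E →L[ℂ] E)) (M Λ G : Matrix (Fin r) (Fin r) ℂ)
    (hG : ∀ i j, G i j = ω.toFunctional (star (b i) * (X * b j - b j * X))) :
    ω.toFunctional (lindbladian b M Λ X) = ∑ i, ∑ j,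
      (-(1 / 2 : ℂ) * M i j * ((starRingEnd ℂ) (G j i) - G i j)
        + Λ i j * ((1 / 2 : ℂ) * (G i j + (starRingEnd ℂ) (G j i)))) := by
  rw [lindbladian_apply, map_sum]
  simp only [map_sum]
  refine Finset.sum_congr rfl fun i _ => Finset.sum_congr rfl fun j _ => ?_
  rw [hG, hG, ← ω.map_star]
  simp only [star_mul, star_sub, star_star, hX.star_eq, mul_sub, map_add, map_sub,
    map_smul, smul_eq_mul, mul_assoc]
  ring

end FreeEnergyDerivative

/-! ### The modular operator and compressions -/

theorem eq_sum_inner_smul_rankOne {E ι : Type*} [NormedAddCommGroup E] [InnerProductSpace ℂ E]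
    [Fintype ι] (e : OrthonormalBasis ι ℂ E) (c : E →L[ℂ] E) :
    c = ∑ i, ∑ j, inner ℂ (e i) (c (e j)) • InnerProductSpace.rankOne ℂ (e i) (e j) := by
  ext v
  conv_lhs => rw [← e.sum_repr' v, map_sum]
  simp only [sum_apply, smul_apply, InnerProductSpace.rankOne_apply]
  rw [Finset.sum_comm]
  refine Finset.sum_congr rfl fun j _ => ?_
  rw [map_smul]
  conv_lhs => rw [← e.sum_repr' (c (e j)), Finset.smul_sum]
  exact Finset.sum_congr rfl fun i _ => smul_comm _ _ _

namespace FaithfulState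

variable {E : Type*} [NormedAddCommGroup E] [InnerProductSpace ℂ E] [CompleteSpace E]
  [FiniteDimensional ℂ E] (ω : FaithfulState E)

theorem isSelfAdjoint_modularOperator : IsSelfAdjoint ω.modularOperator := by
  rw [ContinuousLinearMap.isSelfAdjoint_iff_isSymmetric]
  intro x y
  obtain ⟨a, rfl⟩ := ω.ket.surjective x
  obtain ⟨b, rfl⟩ := ω.ket.surjective y
  rw [ContinuousLinearMap.coe_coe, ← inner_conj_symm, inner_modularOperator,
    inner_modularOperator, ← ω.map_star]
  simp

theorem re_inner_modularOperator_pos (x : ω.GNSSpace) (hx : x ≠ 0) :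
    0 < (inner ℂ x (ω.modularOperator x)).re := by
  obtain ⟨a, rfl⟩ := ω.ket.surjective x
  have ha : star a ≠ 0 := by
    rintro h
    rw [star_eq_zero] at h
    exact hx (by rw [h, map_zero])
  simpa [inner_modularOperator] using ω.re_pos ha

/-- The modular operator acts on matrix units of an eigenbasis of the density operator `ρ` by the
ratio of eigenvalues, as `Δ|b⟩ = |ρ b ρ⁻¹⟩`. -/
theorem modularOperator_ket_rankOne {x y : E} {l m : ℝ} (hm : m ≠ 0)
    (hx : densityOperator ω.toFunctional x = (l : ℂ) • x)
    (hy : densityOperator ω.toFunctional y = (m : ℂ) • y) :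
    ω.modularOperator (ω.ket (InnerProductSpace.rankOne ℂ x y)) =
      ((l / m : ℝ) : ℂ) • ω.ket (InnerProductSpace.rankOne ℂ x y) := by
  set ρ := densityOperator ω.toFunctional with hρ
  have hρsa : IsSelfAdjoint ρ := ω.isSelfAdjoint_densityOperator
  refine ext_inner_left ℂ fun z => ?_
  obtain ⟨a, rfl⟩ := ω.ket.surjective z
  have h1 : ρ * InnerProductSpace.rankOne ℂ x y = (l : ℂ) • InnerProductSpace.rankOne ℂ x y := by
    ext w
    simp only [mul_apply_eq_comp, smul_apply, InnerProductSpace.rankOne_apply, map_smul, hx]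
    exact smul_comm _ _ _
  have h2 : InnerProductSpace.rankOne ℂ x y * ρ = (m : ℂ) • InnerProductSpace.rankOne ℂ x y := by
    ext w
    simp only [mul_apply_eq_comp, smul_apply, InnerProductSpace.rankOne_apply,
      inner_apply_of_eigenvector hρsa hy, smul_smul]
  have hm' : (m : ℂ) ≠ 0 := by exact_mod_cast hm
  rw [inner_modularOperator, inner_smul_right, inner_ket, ← opTrace_densityOperator_mul,
    ← opTrace_densityOperator_mul, ← hρ, ← mul_assoc, h1, opTrace_mul_comm ρ, mul_assoc, h2,
    smul_mul_assoc, mul_smul_comm]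
  have hsmul (z : ℂ) (c : E →L[ℂ] E) : opTrace (z • c) = z * opTrace c := by simp [opTrace]
  rw [hsmul, hsmul, opTrace_mul_comm _ (star a)]
  push_cast
  field_simp

/-- The logarithm of the modular operator is the commutator with `log ρ`. -/
theorem log_modularOperator_ket (c : E →L[ℂ] E) :
    CFC.log ω.modularOperator (ω.ket c) =
      ω.ket (CFC.log (densityOperator ω.toFunctional) * c -
        c * CFC.log (densityOperator ω.toFunctional)) := by
  set ρ := densityOperator ω.toFunctional with hρ
  have hρsa : IsSelfAdjoint ρ := ω.isSelfAdjoint_densityOperator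
  obtain ⟨e, l, he⟩ := exists_eigenbasis ρ hρsa
  have hl (i) : 0 < l i :=
    eigenvalue_pos_of_inner_pos ω.inner_densityOperator_pos (e.norm_eq_one i) (he i)
  have hlog (i) : CFC.log ρ (e i) = (Real.log (l i) : ℂ) • e i :=
    cfc_apply_of_eigenvector ρ hρsa Real.log (he i)
  -- both sides are linear in `c`, so it suffices to take matrix units
  have hunit (i j) : CFC.log ω.modularOperator (ω.ket (InnerProductSpace.rankOne ℂ (e i) (e j))) =
      ω.ket (CFC.log ρ * InnerProductSpace.rankOne ℂ (e i) (e j) -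
        InnerProductSpace.rankOne ℂ (e i) (e j) * CFC.log ρ) := by
    rw [CFC.log, cfc_apply_of_eigenvector _ ω.isSelfAdjoint_modularOperator Real.log
      (ω.modularOperator_ket_rankOne (hl j).ne' (he i) (he j)), ← map_smul]
    congr 1
    ext w
    rw [Real.log_div (hl i).ne' (hl j).ne']
    simp only [sub_apply, mul_apply_eq_comp, smul_apply, InnerProductSpace.rankOne_apply, map_smul,
      hlog, inner_apply_of_eigenvector IsSelfAdjoint.log (hlog j), Complex.ofReal_sub]
    module
  rw [eq_sum_inner_smul_rankOne e c]
  simp only [map_sum, map_smul, hunit, Finset.mul_sum, Finset.sum_mul, mul_smul_comm,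
    smul_mul_assoc, map_sub, ← Finset.sum_sub_distrib, smul_sub]

theorem gnsHamiltonian_ket {h : E →L[ℂ] E} (hh : IsSelfAdjoint h) (c : E →L[ℂ] E) :
    ω.gnsHamiltonian h (ω.ket c) = ω.ket (h * c - c * h) := by
  rw [gnsHamiltonian, sub_apply, leftRep_ket, rightRep_ket, hh.star_eq, map_sub]

/-- The space is unchanged by all `Δ^{it}` only if it is unchanged by their generator. -/
theorem ModularInvariant.log_mem {r : ℕ} {b : Fin r → (E →L[ℂ] E)} (hb : ω.ModularInvariant b)
    {v : ω.GNSSpace} (hv : v ∈ ω.ketSpan b) : CFC.log ω.modularOperator v ∈ ω.ketSpan b := by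
  set X := CFC.log ω.modularOperator
  have h1 : HasDerivAt (fun z : ℂ => NormedSpace.exp (z • X)) X 0 := hasDerivAt_exp_smul_zero X
  have h2 : HasDerivAt (fun z : ℂ => NormedSpace.exp (z • X) v) (X v) 0 :=
    (ContinuousLinearMap.apply ℂ ω.GNSSpace v).hasFDerivAt.comp_hasDerivAt 0 h1
  have h3 : HasDerivAt (fun t : ℝ => ω.modularFlow t v) (Complex.I • X v) 0 := by
    have h4 : HasDerivAt (fun t : ℝ => (t : ℂ) * Complex.I) (1 * Complex.I) 0 :=
      (hasDerivAt_id (0 : ℝ)).ofReal_comp.mul_const _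
    rw [one_mul] at h4
    exact HasDerivAt.scomp (𝕜 := ℝ) 0 (by simpa using h2) h4
  have hclosed : IsClosed (ω.ketSpan b : Set ω.GNSSpace) := (ω.ketSpan b).closed_of_finiteDimensional
  have h5 : Complex.I • X v ∈ ω.ketSpan b := by
    -- a derivative is a limit of difference quotients, which lie in the closed subspace
    have hzero : ω.modularFlow 0 v = v := by
      have h0 : (((0 : ℝ) : ℂ) * Complex.I) • CFC.log ω.modularOperator = 0 :=
        ContinuousLinearMap.ext fun x => by simp
      rw [modularFlow, h0, NormedSpace.exp_zero]
      rfl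
    refine hclosed.mem_of_tendsto h3.tendsto_slope
      (Filter.Eventually.of_forall fun t => ?_)
    rw [slope_def_module, hzero, RCLike.real_smul_eq_coe_smul (K := ℂ)]
    exact (ω.ketSpan b).smul_mem _ ((ω.ketSpan b).sub_mem (hb t v hv) hv)
  have h6 := (ω.ketSpan b).smul_mem (-Complex.I) h5
  rwa [smul_smul, neg_mul, Complex.I_mul_I, neg_neg, one_smul] at h6

theorem inner_compression (K : Submodule ℂ ω.GNSSpace) (X : ω.GNSSpace →L[ℂ] ω.GNSSpace)
    (v w : K) : inner ℂ v (ω.compression K X w) = inner ℂ (v : ω.GNSSpace) (X w) := by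
  simp [compression, Submodule.adjoint_orthogonalProjectionOnto]

theorem isSelfAdjoint_compression (K : Submodule ℂ ω.GNSSpace) {X : ω.GNSSpace →L[ℂ] ω.GNSSpace}
    (hX : IsSelfAdjoint X) : IsSelfAdjoint (ω.compression K X) := by
  rw [ContinuousLinearMap.isSelfAdjoint_iff_isSymmetric]
  intro x y
  rw [ContinuousLinearMap.coe_coe, ← inner_conj_symm, inner_compression, inner_compression,
    inner_conj_symm]
  exact hX.isSymmetric _ _

set_option maxSynthPendingDepth 4 in
/-- On a subspace invariant under `log A`, compression commutes with the logarithm: eigenvectors of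
the restriction of `log A` are eigenvectors of `A`. -/
theorem compression_log_of_invariant {A : ω.GNSSpace →L[ℂ] ω.GNSSpace} (hA : IsSelfAdjoint A)
    (hpos : ∀ x ≠ 0, 0 < (inner ℂ x (A x)).re) (K : Submodule ℂ ω.GNSSpace)
    (hK : ∀ v ∈ K, CFC.log A v ∈ K) :
    ω.compression K (CFC.log A) = CFC.log (ω.compression K A) := by
  have hsaK := ω.isSelfAdjoint_compression K (X := CFC.log A) IsSelfAdjoint.log
  have hsaA := ω.isSelfAdjoint_compression K hA
  have hcomp (X : ω.GNSSpace →L[ℂ] ω.GNSSpace) (u : K) (hu : X u ∈ K) :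
      (ω.compression K X u : ω.GNSSpace) = X u := by
    have h : ω.compression K X u = ⟨X u, hu⟩ :=
      ext_inner_left ℂ fun w => by rw [inner_compression, Submodule.coe_inner]
    rw [h]
  obtain ⟨e, l, he⟩ := exists_eigenbasis A hA
  obtain ⟨u, c, hu⟩ := exists_eigenbasis (ω.compression K (CFC.log A)) hsaK
  have hl (i) : 0 < l i := eigenvalue_pos_of_inner_pos hpos (e.norm_eq_one i) (he i)
  have hAu (k) : A (u k) = (Real.exp (c k) : ℂ) • (u k : ω.GNSSpace) := by
    have hlog : CFC.log A (u k) = (c k : ℂ) • (u k : ω.GNSSpace) := by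
      rw [← hcomp _ (u k) (hK _ (u k).2), hu, Submodule.coe_smul]
    refine e.repr.injective (PiLp.ext fun i => ?_)
    rw [e.repr_apply_apply, e.repr_apply_apply, inner_apply_of_eigenvector hA (he i),
      inner_smul_right]
    have h1 : (Real.log (l i) : ℂ) * inner ℂ (e i) (u k : ω.GNSSpace) =
        (c k : ℂ) * inner ℂ (e i) (u k : ω.GNSSpace) := by
      have h0 := inner_apply_of_eigenvector (A := CFC.log A) IsSelfAdjoint.log
        (cfc_apply_of_eigenvector A hA Real.log (he i)) (u k : ω.GNSSpace)
      rw [← h0, hlog, inner_smul_right]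
    rcases mul_eq_mul_right_iff.1 h1 with h2 | h2
    · rw [← Complex.ofReal_injective h2, Real.exp_log (hl i)]
    · rw [h2, mul_zero, mul_zero]
  have hBu (k) : ω.compression K A (u k) = (Real.exp (c k) : ℂ) • u k := by
    have hmem : A (u k) ∈ K := hAu k ▸ K.smul_mem _ (u k).2
    exact Subtype.ext (by rw [hcomp _ _ hmem, hAu, Submodule.coe_smul])
  refine ContinuousLinearMap.coe_injective (u.toBasis.ext fun k => ?_)
  have h := cfc_apply_of_eigenvector _ hsaA Real.log (hBu k)
  rw [Real.log_exp] at h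
  rw [OrthonormalBasis.coe_toBasis, ContinuousLinearMap.coe_coe, ContinuousLinearMap.coe_coe, hu]
  exact h.symm

end FaithfulState

/-! ### Stability as positivity of a compression -/

namespace FaithfulState

variable {E : Type*} [NormedAddCommGroup E] [InnerProductSpace ℂ E] [CompleteSpace E]
  [FiniteDimensional ℂ E] (ω : FaithfulState E)

/-- The operator `T log Δ + H` is the commutator with `T log ρ + h`. -/
theorem araki_sewell_ket {h : E →L[ℂ] E} (hh : IsSelfAdjoint h) (T : ℂ) (c : E →L[ℂ] E) :
    (T • CFC.log ω.modularOperator + ω.gnsHamiltonian h) (ω.ket c) =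
      ω.ket ((T • CFC.log (densityOperator ω.toFunctional) + h) * c -
        c * (T • CFC.log (densityOperator ω.toFunctional) + h)) := by
  rw [add_apply, smul_apply, log_modularOperator_ket, gnsHamiltonian_ket ω hh, ← map_smul,
    ← map_add]
  congr 1
  simp only [smul_sub, add_mul, mul_add, smul_mul_assoc, mul_smul_comm]
  abel

omit [FiniteDimensional ℂ E] in
theorem inner_sum_ket {r : ℕ} (b : Fin r → (E →L[ℂ] E)) (S : ω.GNSSpace →L[ℂ] ω.GNSSpace)
    (x : Fin r → ℂ) :
    inner ℂ (∑ i, x i • ω.ket (b i)) (S (∑ i, x i • ω.ket (b i))) =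
      ∑ i, ∑ j, (starRingEnd ℂ) (x i) * x j * inner ℂ (ω.ket (b i)) (S (ω.ket (b j))) := by
  rw [map_sum, sum_inner]
  refine Finset.sum_congr rfl fun i _ => ?_
  rw [inner_sum]
  refine Finset.sum_congr rfl fun j _ => ?_
  rw [map_smul, inner_smul_left, inner_smul_right]
  ring

/-- Restricted thermodynamic stability is positivity of the compression of `T log Δ + H`. Testing
with rank-one `M` and `Λ` yields one direction; conversely a positive semidefinite `Λ` is a sum of
rank-one matrices. -/
theorem rts_iff_isPositive_compression {h : E →L[ℂ] E} (hh : IsSelfAdjoint h) (T : ℝ) {r : ℕ}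
    (b : Fin r → (E →L[ℂ] E)) :
    RTS ω h T b ↔ (ω.compression (ω.ketSpan b)
      ((T : ℂ) • CFC.log ω.modularOperator + ω.gnsHamiltonian h)).toLinearMap.IsPositive := by
  set X := (T : ℂ) • CFC.log (densityOperator ω.toFunctional) + h with hX
  set S := (T : ℂ) • CFC.log ω.modularOperator + ω.gnsHamiltonian h with hS
  have hXsa : IsSelfAdjoint X :=
    (IsSelfAdjoint.smul (Complex.conj_ofReal T) IsSelfAdjoint.log).add hh
  let G : Matrix (Fin r) (Fin r) ℂ := fun i j => inner ℂ (ω.ket (b i)) (S (ω.ket (b j)))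
  have hG (i j) : G i j = ω.toFunctional (star (b i) * (X * b j - b j * X)) := by
    simp only [G]
    rw [hS, araki_sewell_ket ω hh, inner_ket]
  have hvar (M Λ : Matrix (Fin r) (Fin r) ℂ) (hM : M.conjTranspose = -M) (hΛ : Λ.PosSemidef) :
      HasDerivAt (fun t : ℝ => freeEnergy T h (evolved (lindbladian b M Λ) ω.toFunctional t))
        (∑ i, ∑ j, (-(1 / 2 : ℂ) * M i j * ((starRingEnd ℂ) (G j i) - G i j)
          + Λ i j * ((1 / 2 : ℂ) * (G i j + (starRingEnd ℂ) (G j i))))).re 0 := by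
    rw [← ω.apply_lindbladian hXsa b M Λ G hG]
    exact hasDerivAt_freeEnergy ω h T (lindbladian_one b M Λ)
      (lindbladian_star b hM hΛ.isHermitian)
  let q (x : Fin r → ℂ) : ℂ := ∑ i, ∑ j, (starRingEnd ℂ) (x i) * x j * G i j
  have hq (x : Fin r → ℂ) : q x = inner ℂ (∑ i, x i • ω.ket (b i)) (S (∑ i, x i • ω.ket (b i))) :=
    (ω.inner_sum_ket b S x).symm
  have hqconj (x : Fin r → ℂ) :
      ∑ i, ∑ j, (starRingEnd ℂ) (x i) * x j * (starRingEnd ℂ) (G j i) = (starRingEnd ℂ) (q x) := by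
    simp only [q, map_sum, map_mul, Complex.conj_conj]
    rw [Finset.sum_comm]
    exact Finset.sum_congr rfl fun i _ => Finset.sum_congr rfl fun j _ => by ring
  constructor
  · intro hrts
    have hqnonneg (x : Fin r → ℂ) : 0 ≤ q x := by
      -- the rank-one matrix with entries `conj (x i) * x j`
      let N : Matrix (Fin r) (Fin r) ℂ := Matrix.vecMulVec (star x) (star (star x))
      have hNij (i j) : N i j = (starRingEnd ℂ) (x i) * x j := by simp [N, Matrix.vecMulVec_apply]
      have hN : N.PosSemidef := Matrix.posSemidef_vecMulVec_self_star _
      -- `M = i s N` and `Λ = c N` give the derivative `c Re q - s Im q`; the sign of `s` is free,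
      -- so `q` must be real
      have htest (s c : ℝ) (hc : 0 ≤ c) : 0 ≤ c * (q x).re - s * (q x).im := by
        have hM : (((s : ℂ) * Complex.I) • N).conjTranspose = -(((s : ℂ) * Complex.I) • N) := by
          rw [Matrix.conjTranspose_smul, hN.isHermitian.eq, ← neg_smul]
          congr 1
          simp
        have hΛ : ((c : ℂ) • N).PosSemidef := hN.smul (by exact_mod_cast hc)
        obtain ⟨d, hd, hd0⟩ := hrts _ _ hM hΛ
        rw [hd.unique (hvar _ _ hM hΛ)] at hd0
        have hsum : ∑ i, ∑ j, (-(1 / 2 : ℂ) * (((s : ℂ) * Complex.I) • N) i j *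
              ((starRingEnd ℂ) (G j i) - G i j)
            + ((c : ℂ) • N) i j * ((1 / 2 : ℂ) * (G i j + (starRingEnd ℂ) (G j i)))) =
            -(1 / 2 : ℂ) * (s * Complex.I) * ((starRingEnd ℂ) (q x) - q x)
              + c * ((1 / 2 : ℂ) * (q x + (starRingEnd ℂ) (q x))) := by
          rw [← hqconj]
          simp only [q, ← Finset.sum_add_distrib, ← Finset.sum_sub_distrib, Finset.mul_sum]
          refine Finset.sum_congr rfl fun i _ => Finset.sum_congr rfl fun j _ => ?_
          simp only [Matrix.smul_apply, smul_eq_mul, hNij]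
          ring
        rw [hsum] at hd0
        have hval : (-(1 / 2 : ℂ) * (s * Complex.I) * ((starRingEnd ℂ) (q x) - q x)
              + c * ((1 / 2 : ℂ) * (q x + (starRingEnd ℂ) (q x)))) =
            ((c * (q x).re - s * (q x).im : ℝ) : ℂ) := by
          apply Complex.ext
          · simp
            ring
          · simp
        rwa [hval, Complex.ofReal_re] at hd0
      have h1 := htest 0 1 zero_le_one
      have h2 := htest (q x).im 0 le_rfl
      refine Complex.le_def.2 ⟨by simpa using h1, ?_⟩
      simp only [Complex.zero_im]
      nlinarith
    rw [LinearMap.isPositive_iff_complex]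
    intro v
    obtain ⟨x, hx⟩ := (Submodule.mem_span_range_iff_exists_fun ℂ).1 v.2
    have h0 := Complex.le_def.1 (hqnonneg x)
    rw [hq, hx, ← inner_compression] at h0
    rw [ContinuousLinearMap.coe_coe, ← inner_conj_symm]
    refine ⟨Complex.ext (Complex.ofReal_re _) ?_, ?_⟩
    · rw [Complex.conj_im, ← h0.2]
      simp
    · exact h0.1.trans_eq (Complex.conj_re _).symm
  · intro hpos M Λ hM hΛ
    refine ⟨_, hvar M Λ hM hΛ, ?_⟩
    have hmem (i) : ω.ket (b i) ∈ ω.ketSpan b := Submodule.subset_span ⟨i, rfl⟩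
    -- positivity includes symmetry, which removes the contribution of `M`
    have hGherm (i j) : (starRingEnd ℂ) (G j i) = G i j := by
      have h1 := hpos.1 ⟨_, hmem i⟩ ⟨_, hmem j⟩
      rw [ContinuousLinearMap.coe_coe, ← inner_conj_symm, inner_compression, inner_compression]
        at h1
      exact h1
    have hqnonneg (x : Fin r → ℂ) : 0 ≤ (q x).re := by
      have hv : ∑ i, x i • ω.ket (b i) ∈ ω.ketSpan b :=
        Submodule.sum_mem _ fun i _ => Submodule.smul_mem _ _ (hmem i)
      have h1 := hpos.2 ⟨_, hv⟩
      rw [ContinuousLinearMap.coe_coe, ← inner_conj_symm, inner_compression] at h1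
      rw [hq]
      exact h1.trans_eq (Complex.conj_re _)
    obtain ⟨C, hC⟩ : ∃ C : Matrix (Fin r) (Fin r) ℂ, Λ = C.conjTranspose * C := by
      open scoped MatrixOrder in
      exact CStarAlgebra.nonneg_iff_eq_star_mul_self.1 hΛ.nonneg
    have hsum : ∑ i, ∑ j, (-(1 / 2 : ℂ) * M i j * ((starRingEnd ℂ) (G j i) - G i j)
          + Λ i j * ((1 / 2 : ℂ) * (G i j + (starRingEnd ℂ) (G j i)))) = ∑ k, q (C k) := by
      have h1 : ∑ k, q (C k) = ∑ i, ∑ j, ∑ k, (starRingEnd ℂ) (C k i) * C k j * G i j := by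
        simp only [q]
        rw [Finset.sum_comm]
        exact Finset.sum_congr rfl fun i _ => Finset.sum_comm
      rw [h1]
      refine Finset.sum_congr rfl fun i _ => Finset.sum_congr rfl fun j _ => ?_
      rw [hGherm, hC, Matrix.mul_apply, ← Finset.sum_mul]
      simp only [Matrix.conjTranspose_apply, RCLike.star_def]
      ring
    rw [hsum, Complex.re_sum]
    exact Finset.sum_nonneg fun k _ => hqnonneg (C k)

set_option maxSynthPendingDepth 4 in
/-- Over an orthonormal basis, `T log (PΔP†) + PHP†` is a positive semidefinite matrix exactly when
the corresponding operator is positive. -/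
theorem posSemidef_iff_isPositive {K : Submodule ℂ ω.GNSSpace} {m : ℕ}
    (a : OrthonormalBasis (Fin m) ℂ K) (T : ℂ) {A : ω.GNSSpace →L[ℂ] ω.GNSSpace}
    (hA : IsSelfAdjoint A) (S : ω.GNSSpace →L[ℂ] ω.GNSSpace) :
    (T • cfc Real.log (ω.compressedMatrix a A) + ω.compressedMatrix a S).PosSemidef ↔
      (T • CFC.log (ω.compression K A) + ω.compression K S).toLinearMap.IsPositive := by
  rw [compressedMatrix, compressedMatrix,
    cfc_toMatrixOrthonormal a Real.log _ (ω.isSelfAdjoint_compression K hA), ← map_smul, ← map_add]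
  exact LinearMap.posSemidef_toMatrix_iff a

set_option maxSynthPendingDepth 4 in
/-- Jensen's inequality for the compression of the modular operator. -/
theorem isPositive_log_compression_sub (K : Submodule ℂ ω.GNSSpace) {T : ℝ} (hT : 0 ≤ T) :
    ((T : ℂ) • CFC.log (ω.compression K ω.modularOperator) -
      (T : ℂ) • ω.compression K (CFC.log ω.modularOperator)).toLinearMap.IsPositive := by
  have hsa := ω.isSelfAdjoint_compression K ω.isSelfAdjoint_modularOperator
  have hlog := ω.isSelfAdjoint_compression K (X := CFC.log ω.modularOperator) IsSelfAdjoint.log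
  have hlog' : IsSelfAdjoint (CFC.log (ω.compression K ω.modularOperator)) := IsSelfAdjoint.log
  refine ⟨IsSelfAdjoint.isSymmetric ?_, fun v => ?_⟩
  · rw [← smul_sub]
    exact IsSelfAdjoint.smul (Complex.conj_ofReal T) (hlog'.sub hlog)
  · have h := inner_log_le_inner_log_compression ω.modularOperator ω.isSelfAdjoint_modularOperator
      ω.re_inner_modularOperator_pos K _ hsa (fun x y => (ω.inner_compression K _ x y).symm) v
    rw [ContinuousLinearMap.coe_coe, ← inner_conj_symm, ← smul_sub, smul_apply, inner_smul_right,
      sub_apply, inner_sub_right, inner_compression]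
    refine le_of_le_of_eq (mul_nonneg hT (sub_nonneg.2 h)) ?_
    rw [RCLike.conj_re]
    exact ((Complex.re_ofReal_mul T _).trans (by rw [Complex.sub_re])).symm

theorem compression_add (K : Submodule ℂ ω.GNSSpace) (X Y : ω.GNSSpace →L[ℂ] ω.GNSSpace) :
    ω.compression K (X + Y) = ω.compression K X + ω.compression K Y := by
  simp [compression, ContinuousLinearMap.add_comp, ContinuousLinearMap.comp_add]

theorem compression_smul (K : Submodule ℂ ω.GNSSpace) (c : ℂ) (X : ω.GNSSpace →L[ℂ] ω.GNSSpace) :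
    ω.compression K (c • X) = c • ω.compression K X := by
  simp [compression]

end FaithfulState

theorem mainTheorem2 {E : Type*} [NormedAddCommGroup E] [InnerProductSpace ℂ E] [CompleteSpace E]
    [FiniteDimensional ℂ E] (ω : FaithfulState E) (h : E →L[ℂ] E) (hh : IsSelfAdjoint h)
    (T : ℝ) (hT : 0 < T) {r : ℕ} (b : Fin r → (E →L[ℂ] E))
    {m : ℕ} (a : OrthonormalBasis (Fin m) ℂ (ω.ketSpan b)) :
    (RTS ω h T b →
      ((T : ℂ) • cfc Real.log (ω.compressedMatrix a ω.modularOperator) +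
        ω.compressedMatrix a (ω.gnsHamiltonian h)).PosSemidef) ∧
    (ω.ModularInvariant b →
      ((T : ℂ) • cfc Real.log (ω.compressedMatrix a ω.modularOperator) +
        ω.compressedMatrix a (ω.gnsHamiltonian h)).PosSemidef →
      RTS ω h T b) := by
  rw [ω.rts_iff_isPositive_compression hh, ω.compression_add, ω.compression_smul,
    ω.posSemidef_iff_isPositive a T ω.isSelfAdjoint_modularOperator]
  refine ⟨fun hrts => ?_, fun hb hpos => ?_⟩
  · have hsum := (ω.isPositive_log_compression_sub (ω.ketSpan b) hT.le).add hrts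
    rwa [← ContinuousLinearMap.toLinearMap_add, ← add_assoc, sub_add_cancel] at hsum
  · rwa [ω.compression_log_of_invariant ω.isSelfAdjoint_modularOperator
      ω.re_inner_modularOperator_pos (ω.ketSpan b) fun v hv => hb.log_mem ω hv]
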